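/- Let $k$ be one of $\mathbb{C}$, $\mathbb{R}$, $\mathbb{Q}_p$ ($p$ a prime), let $K\supseteq k$ be an algebraically closed field, and let $G\le \mathrm{GL}_n(K)$ be a Zariski-closed subgroup defined over $k$, i.e. the ideal $I\subseteq K[x_{ij}]$ of all polynomials in the $n^2$ matrix entries that vanish on $G$ is generated by polynomials with coefficients in $k$. Put $G_k=G\cap \mathrm{GL}_n(k)$ and let $$L(G)_k=\Big\{X\in M_n(k)\ :\ \sum_{i,j}\frac{\partial P}{\partial x_{ij}}(\mathrm{Id}_n)\,X_{ij}=0\ \text{ for all } P\in I\Big\},$$ a Lie algebra over $k$ with bracket $[A,B]=AB-BA$, on which $G_k$ acts by $\mathrm{Ad}(g)X=gXg^{-1}$. Let $H$ be a subgroup of $G_k$ that is Zariski dense in $G_k$ (every polynomial in the matrix entries that vanishes on $H$ vanishes on $G_k$). Then: 1. $\mathrm{Ad}(H)$ and $\mathrm{Ad}(G_k)$ span the same $k$-subspace of $\mathrm{End}_k\,L(G)_k$. 2. If moreover $H$ is a $k$-analytic subgroup of $G_k$ (that is, $H$ is the image of an injective $k$-analytic immersive homomorphism $\iota:\mathcal{H}\to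 G_k\subseteq M_n(k)$ from a $k$-analytic group $\mathcal{H}$: a complex or real Lie group, or a $p$-adic analytic group), then the Lie algebra of $\mathcal{H}$, i.e. its tangent space at the identity regarded as the subspace $d\iota_1(T_1\mathcal{H})$ of $M_n(k)$, is contained in $L(G)_k$ and is an ideal of the Lie algebra $L(G)_k$. -/

import Mathlib

open scoped Manifold ContDiff

/-- `k` is, as a normed field, one of the complex numbers, the real numbers, or the `p`-adic
numbers for some prime `p`. -/
def IsComplexRealOrPadic (k : Type*) [NontriviallyNormedField k] : Prop :=
  (∃ e : k ≃+* ℂ, ∀ x, ‖e x‖ = ‖x‖) ∨ (∃ e : k ≃+* ℝ, ∀ x, ‖e x‖ = ‖x‖) ∨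
    ∃ (p : ℕ) (_ : Fact p.Prime) (e : k ≃+* ℚ_[p]), ∀ x, ‖e x‖ = ‖x‖

-- the commutator bracket `[A, B] = AB - BA` on matrices
attribute [local instance 100] LieRing.ofAssociativeRing

namespace LinAlgGroup

open MvPolynomial

/-! ### The Zariski topology on matrices -/

/-- The matrix `A` as a point of affine `n^2`-space. -/
def coords {R : Type*} {n : ℕ} (A : Matrix (Fin n) (Fin n) R) : Fin n × Fin n → R :=
  fun q => A q.1 q.2

/-- `G` is a Zariski-closed subgroup of `GL_n(K)`: it is cut out in `GL_n(K)` by polynomial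
equations in the matrix entries. -/
def IsZariskiClosed {K : Type*} [Field K] {n : ℕ} (G : Subgroup (GL (Fin n) K)) : Prop :=
  ∃ I : Ideal (MvPolynomial (Fin n × Fin n) K),
    ∀ g : GL (Fin n) K, g ∈ G ↔ coords (g : Matrix (Fin n) (Fin n) K) ∈ zeroLocus K I

/-- The ideal of all polynomials in the `n^2` matrix entries that vanish on `G`. -/
noncomputable def ideal {K : Type*} [Field K] {n : ℕ} (G : Subgroup (GL (Fin n) K)) :
    Ideal (MvPolynomial (Fin n × Fin n) K) :=
  vanishingIdeal K ((fun g : GL (Fin n) K => coords (g : Matrix (Fin n) (Fin n) K)) '' G)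

/-- `G` is defined over `k`: its ideal is generated by polynomials with coefficients in `k`. -/
def IsDefinedOver (k : Type*) {K : Type*} [Field k] [Field K] [Algebra k K] {n : ℕ}
    (G : Subgroup (GL (Fin n) K)) : Prop :=
  ∃ S : Set (MvPolynomial (Fin n × Fin n) k),
    ideal G = Ideal.span (MvPolynomial.map (algebraMap k K) '' S)

/-- The group `G_k = G ∩ GL_n(k)` of `k`-rational points. -/
def rationalPoints (k : Type*) {K : Type*} [Field k] [Field K] [Algebra k K] {n : ℕ}
    (G : Subgroup (GL (Fin n) K)) : Subgroup (GL (Fin n) k) :=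
  G.comap (Matrix.GeneralLinearGroup.map (algebraMap k K))

/-- A `k`-rational point of `G`, as a point of affine `n^2`-space over `K`. -/
def pointCoords {k K : Type*} [Field k] [Field K] [Algebra k K] {n : ℕ}
    {G : Subgroup (GL (Fin n) K)} (g : rationalPoints k G) : Fin n × Fin n → K :=
  coords (((g : GL (Fin n) k) : Matrix (Fin n) (Fin n) k).map (algebraMap k K))

/-- The subgroup `H` of `G_k` is Zariski dense in `G_k`: the Zariski closure of `H` (the zero set
of all polynomials that vanish on `H`) contains `G_k`. -/
def IsZariskiDense {k K : Type*} [Field k] [Field K] [Algebra k K] {n : ℕ}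
    {G : Subgroup (GL (Fin n) K)} (H : Subgroup (rationalPoints k G)) : Prop :=
  Set.range (pointCoords (k := k) (G := G)) ⊆
    zeroLocus K (vanishingIdeal K (pointCoords '' (H : Set (rationalPoints k G))))

/-! ### The Lie algebra -/

/-- The differential at the identity matrix of the polynomial `P`, in the direction `X`. -/
noncomputable def dAtOne {K : Type*} [Field K] {n : ℕ} (P : MvPolynomial (Fin n × Fin n) K)
    (X : Matrix (Fin n) (Fin n) K) : K :=
  ∑ i, ∑ j, eval (coords (1 : Matrix (Fin n) (Fin n) K)) (pderiv (i, j) P) * X i j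

section aux

variable {K : Type*} [Field K] {n : ℕ}

/-- Auxiliary: the left-invariant derivation attached to the matrix `X`. -/
noncomputable def leftDer (X : Matrix (Fin n) (Fin n) K) :
    Derivation K (MvPolynomial (Fin n × Fin n) K) (MvPolynomial (Fin n × Fin n) K) :=
  mkDerivation K fun q => ∑ l, MvPolynomial.X (q.1, l) * C (X l q.2)

/-- Auxiliary: the substitution `x ↦ g x h`. -/
noncomputable def subst (g h : Matrix (Fin n) (Fin n) K) :
    MvPolynomial (Fin n × Fin n) K →ₐ[K] MvPolynomial (Fin n × Fin n) K :=
  aeval fun q => ∑ a, ∑ b, C (g q.1 a) * MvPolynomial.X (a, b) * C (h b q.2)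

theorem eval_subst (g h x : Matrix (Fin n) (Fin n) K) (P : MvPolynomial (Fin n × Fin n) K) :
    eval (coords x) (subst g h P) = eval (coords (g * x * h)) P := by
  induction P using MvPolynomial.induction_on with
  | C a => simp [subst]
  | add p q hp hq => simp [hp, hq]
  | mul_X p q hp =>
    simp only [map_mul, hp, eval_X]
    congr 1
    simp only [subst, aeval_X, map_sum, map_mul, eval_C, eval_X, coords, Matrix.mul_apply,
      Finset.sum_mul]
    exact Finset.sum_comm

theorem dAtOne_eq (P : MvPolynomial (Fin n × Fin n) K) (X : Matrix (Fin n) (Fin n) K) :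
    dAtOne P X = eval (coords (1 : Matrix (Fin n) (Fin n) K)) (leftDer X P) := by
  induction P using MvPolynomial.induction_on with
  | C a => simp [dAtOne]
  | add p q hp hq =>
    rw [map_add, map_add, ← hp, ← hq]
    simp [dAtOne, add_mul, Finset.sum_add_distrib]
  | mul_X p q hp =>
    rw [Derivation.leibniz, map_add, smul_eq_mul, smul_eq_mul, map_mul, map_mul, ← hp]
    have h1 : eval (coords (1 : Matrix (Fin n) (Fin n) K)) (leftDer X (MvPolynomial.X q))
        = X q.1 q.2 := by
      simp [leftDer, coords, Matrix.one_apply]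
    rw [h1]
    simp only [dAtOne, Derivation.leibniz, smul_eq_mul, map_add, map_mul, add_mul,
      Finset.sum_add_distrib, Finset.mul_sum]
    congr 1
    · rw [Finset.sum_eq_single q.1, Finset.sum_eq_single q.2]
      · simp
      · intro j _ hj
        rw [pderiv_X_of_ne (by intro h; exact hj (by rw [h]))]; simp
      · simp
      · intro i _ hi
        refine Finset.sum_eq_zero fun j _ => ?_
        rw [pderiv_X_of_ne (by intro h; exact hi (by rw [h]))]; simp
      · simp
    · simp only [mul_assoc]

theorem leftDer_subst (g h X Y : Matrix (Fin n) (Fin n) K) (hY : X * h = h * Y)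
    (P : MvPolynomial (Fin n × Fin n) K) :
    leftDer X (subst g h P) = subst g h (leftDer Y P) := by
  induction P using MvPolynomial.induction_on with
  | C a => simp [subst]
  | add p q hp hq => simp [hp, hq]
  | mul_X p q hp =>
    have h1 : leftDer X (subst g h (MvPolynomial.X q)) =
        subst g h (leftDer Y (MvPolynomial.X q)) := by
      have e : ∀ l, ∑ b, X l b * h b q.2 = ∑ b, h l b * Y b q.2 := fun l => by
        have := congrFun (congrFun hY l) q.2
        simpa only [Matrix.mul_apply] using this
      have lhs : leftDer X (subst g h (MvPolynomial.X q)) =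
          ∑ a, ∑ l, C (g q.1 a) * MvPolynomial.X (a, l) * C (∑ b, X l b * h b q.2) := by
        simp only [subst, aeval_X, map_sum, Derivation.leibniz, leftDer, mkDerivation_X,
          MvPolynomial.derivation_C, mul_zero, add_zero, zero_add, smul_eq_mul, map_mul,
          Finset.mul_sum]
        refine Finset.sum_congr rfl fun a _ => ?_
        rw [Finset.sum_comm]
        exact Finset.sum_congr rfl fun l _ => Finset.sum_congr rfl fun b _ => by ring
      rw [lhs]
      simp only [e]
      simp only [subst, leftDer, mkDerivation_X, map_sum, map_mul, aeval_X, algHom_C,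
        algebraMap_eq, Finset.mul_sum, Finset.sum_mul]
      refine (Finset.sum_congr rfl fun a _ => Finset.sum_comm).trans ?_
      refine Finset.sum_comm.trans ?_
      exact Finset.sum_congr rfl fun b _ => Finset.sum_congr rfl fun a _ =>
        Finset.sum_congr rfl fun l _ => by ring
    simp only [map_mul, Derivation.leibniz, smul_eq_mul, map_add, hp, h1]

theorem leftDer_lie (X Y : Matrix (Fin n) (Fin n) K) (P : MvPolynomial (Fin n × Fin n) K) :
    leftDer ⁅X, Y⁆ P = leftDer X (leftDer Y P) - leftDer Y (leftDer X P) := by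
  have key : ∀ (X Y : Matrix (Fin n) (Fin n) K) (q : Fin n × Fin n),
      leftDer X (leftDer Y (MvPolynomial.X q)) =
        ∑ l, MvPolynomial.X (q.1, l) * C ((X * Y) l q.2) := by
    intro X Y q
    simp only [leftDer, mkDerivation_X, map_sum, Derivation.leibniz, MvPolynomial.derivation_C,
      mul_zero, zero_add, smul_eq_mul, Matrix.mul_apply, map_mul, Finset.mul_sum]
    rw [Finset.sum_comm]
    exact Finset.sum_congr rfl fun l _ => Finset.sum_congr rfl fun b _ => by ring
  have : leftDer ⁅X, Y⁆ = ⁅leftDer X, leftDer Y⁆ := by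
    refine MvPolynomial.derivation_ext fun q => ?_
    rw [Derivation.commutator_apply, key, key, ← Finset.sum_sub_distrib]
    simp [leftDer, Ring.lie_def, mul_sub]
  rw [this, Derivation.commutator_apply]

theorem mem_ideal {G : Subgroup (GL (Fin n) K)} {P : MvPolynomial (Fin n × Fin n) K} :
    P ∈ ideal G ↔ ∀ g ∈ G, eval (coords (g : Matrix (Fin n) (Fin n) K)) P = 0 := by
  simp [ideal, mem_vanishingIdeal_iff, aeval_eq_eval]

theorem subst_mem {G : Subgroup (GL (Fin n) K)} {g h : GL (Fin n) K} (hg : g ∈ G) (hh : h ∈ G)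
    {P : MvPolynomial (Fin n × Fin n) K} (hP : P ∈ ideal G) : subst g.1 h.1 P ∈ ideal G := by
  rw [mem_ideal] at hP ⊢
  intro x hx
  rw [eval_subst]
  exact hP (g * x * h) (G.mul_mem (G.mul_mem hg hx) hh)

theorem leftDer_mem {G : Subgroup (GL (Fin n) K)} {X : Matrix (Fin n) (Fin n) K}
    (hX : ∀ P ∈ ideal G, dAtOne P X = 0) {P : MvPolynomial (Fin n × Fin n) K}
    (hP : P ∈ ideal G) : leftDer X P ∈ ideal G := by
  rw [mem_ideal]
  intro g hg
  have h := hX _ (subst_mem hg G.one_mem hP)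
  rw [dAtOne_eq, leftDer_subst _ _ X X (by simp), eval_subst] at h
  simpa using h

theorem dAtOne_conj {G : Subgroup (GL (Fin n) K)} {g : GL (Fin n) K} (hg : g ∈ G)
    {X : Matrix (Fin n) (Fin n) K} (hX : ∀ P ∈ ideal G, dAtOne P X = 0)
    {P : MvPolynomial (Fin n × Fin n) K} (hP : P ∈ ideal G) :
    dAtOne P (g.1 * X * g⁻¹.1) = 0 := by
  have h := hX _ (subst_mem hg (G.inv_mem hg) hP)
  rw [dAtOne_eq, leftDer_subst _ _ X (g.1 * X * g⁻¹.1)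
    (by rw [← mul_assoc, ← mul_assoc, Units.inv_mul, one_mul]), eval_subst, mul_one,
    Units.mul_inv] at h
  rw [dAtOne_eq, h]

end aux

/-- The Lie algebra `L(G)`: the matrices that annihilate the differentials at the identity of all
polynomials vanishing on `G`, with the Lie bracket `[A, B] = AB - BA`. -/
noncomputable def lieAlgebra {K : Type*} [Field K] {n : ℕ} (G : Subgroup (GL (Fin n) K)) :
    LieSubalgebra K (Matrix (Fin n) (Fin n) K) where
  carrier := {X | ∀ P ∈ ideal G, dAtOne P X = 0}
  zero_mem' := by intro P _; simp [dAtOne]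
  add_mem' := by
    intro X Y hX hY P hP
    have h : dAtOne P (X + Y) = dAtOne P X + dAtOne P Y := by
      simp [dAtOne, mul_add, Finset.sum_add_distrib]
    rw [h, hX P hP, hY P hP, add_zero]
  smul_mem' := by
    intro c X hX P hP
    have h : dAtOne P (c • X) = c * dAtOne P X := by
      simp only [dAtOne, Matrix.smul_apply, smul_eq_mul, Finset.mul_sum]
      exact Finset.sum_congr rfl fun i _ => Finset.sum_congr rfl fun j _ => by ring
    rw [h, hX P hP, mul_zero]
  lie_mem' := by
    intro X Y hX hY P hP
    rw [dAtOne_eq, leftDer_lie, map_sub, ← dAtOne_eq, ← dAtOne_eq,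
      hX _ (leftDer_mem hY hP), hY _ (leftDer_mem hX hP), sub_zero]

/-- The Lie algebra `L(G)_k = L(G) ∩ M_n(k)` over `k`. -/
noncomputable def lieAlgebraPoints (k : Type*) {K : Type*} [Field k] [Field K] [Algebra k K]
    {n : ℕ} (G : Subgroup (GL (Fin n) K)) : LieSubalgebra k (Matrix (Fin n) (Fin n) k) where
  carrier := {X | X.map (algebraMap k K) ∈ lieAlgebra G}
  zero_mem' := by
    simp [Matrix.map_zero]
  add_mem' := by
    intro X Y hX hY
    simp only [Set.mem_ofPred_eq] at *
    rw [Matrix.map_add _ (map_add _)]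
    exact add_mem hX hY
  smul_mem' := by
    intro c X hX
    simp only [Set.mem_ofPred_eq] at *
    have : (c • X).map (algebraMap k K) = algebraMap k K c • X.map (algebraMap k K) := by
      ext i j; simp
    rw [this]
    exact (lieAlgebra G).smul_mem _ hX
  lie_mem' := by
    intro X Y hX hY
    have : (⁅X, Y⁆).map (algebraMap k K) =
        ⁅X.map (algebraMap k K), Y.map (algebraMap k K)⁆ := by
      simp only [Ring.lie_def, Matrix.map_sub _ (map_sub _), Matrix.map_mul]
    change (⁅X, Y⁆).map (algebraMap k K) ∈ lieAlgebra G
    rw [this]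
    exact (lieAlgebra G).lie_mem hX hY

theorem conj_mem {k K : Type*} [Field k] [Field K] [Algebra k K] {n : ℕ}
    {G : Subgroup (GL (Fin n) K)} (g : rationalPoints k G) (X : lieAlgebraPoints k G) :
    (g : GL (Fin n) k).1 * (X : Matrix (Fin n) (Fin n) k) * (g : GL (Fin n) k)⁻¹.1 ∈
      lieAlgebraPoints k G := by
  change Matrix.map _ (algebraMap k K) ∈ lieAlgebra G
  have hX : (X : Matrix (Fin n) (Fin n) k).map (algebraMap k K) ∈ lieAlgebra G := X.2
  rw [Matrix.map_mul, Matrix.map_mul]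
  have h := fun P (hP : P ∈ ideal G) => 
    dAtOne_conj (g := Matrix.GeneralLinearGroup.map (algebraMap k K) g) g.2 hX hP
  rw [← map_inv] at h
  exact h

/-- The adjoint action of `G_k` on `L(G)_k`: `Ad(g) X = g X g⁻¹`. -/
noncomputable def Ad (k : Type*) {K : Type*} [Field k] [Field K] [Algebra k K] {n : ℕ}
    (G : Subgroup (GL (Fin n) K)) : rationalPoints k G →* Module.End k (lieAlgebraPoints k G) where
  toFun g :=
    { toFun := fun X => ⟨_, conj_mem g X⟩
      map_add' := fun X Y => by ext1; simp [mul_add, add_mul]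
      map_smul' := fun c X => by ext1; simp }
  map_one' := by ext1 X; ext1; simp
  map_mul' g h := by ext1 X; ext1; simp [mul_assoc]

/-! ### Analytic subgroups -/

/-- The homomorphism `ι : L → G_k`, read in the matrix entries: a map from `L` to the normed space
`k^(n^2)` of `n × n` arrays. -/
def toArray {k K : Type*} [Field k] [Field K] [Algebra k K] {n : ℕ}
    {G : Subgroup (GL (Fin n) K)} {L : Type*} [Group L] (ι : L →* rationalPoints k G) (x : L) :
    Fin n → Fin n → k :=
  fun i j => ((ι x : GL (Fin n) k) : Matrix (Fin n) (Fin n) k) i j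

/-- The homomorphism `ι` exhibits the group `L` as an analytic subgroup (Lie subgroup) of `G_k`
with underlying group `H`: `L` is a `k`-analytic group modelled on `E`, and `ι` is an injective
analytic immersion with image `H`. -/
structure IsAnalyticSubgroup {k K : Type*} [NontriviallyNormedField k] [Field K] [Algebra k K]
    {n : ℕ} {G : Subgroup (GL (Fin n) K)} (H : Subgroup (rationalPoints k G))
    (E : Type*) [NormedAddCommGroup E] [NormedSpace k E]
    {L : Type*} [Group L] [TopologicalSpace L] [ChartedSpace E L]
    (ι : L →* rationalPoints k G) : Prop where
  lieGroup : LieGroup 𝓘(k, E) ω L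
  injective : Function.Injective ι
  range_eq : ι.range = H
  analytic : ContMDiff 𝓘(k, E) 𝓘(k, Fin n → Fin n → k) ω (toArray ι)
  immersion : ∀ x : L,
    Function.Injective (mfderiv 𝓘(k, E) 𝓘(k, Fin n → Fin n → k) (toArray ι) x)

/-- The Lie algebra of the analytic subgroup given by `ι`: its tangent space at the identity, as a
subspace of `M_n(k)` (the image of the differential of `ι` at the identity). -/
noncomputable def tangentAtOne {k K : Type*} [NontriviallyNormedField k] [Field K] [Algebra k K]
    {n : ℕ} {G : Subgroup (GL (Fin n) K)}
    (E : Type*) [NormedAddCommGroup E] [NormedSpace k E]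
    {L : Type*} [Group L] [TopologicalSpace L] [ChartedSpace E L]
    (ι : L →* rationalPoints k G) : Submodule k (Matrix (Fin n) (Fin n) k) :=
  let D : E →L[k] (Fin n → Fin n → k) :=
    mfderiv 𝓘(k, E) 𝓘(k, Fin n → Fin n → k) (toArray ι) (1 : L)
  (LinearMap.range D.toLinearMap).map (Matrix.ofLinearEquiv k).toLinearMap

end LinAlgGroup

namespace IsComplexRealOrPadic

variable {k : Type*} [NontriviallyNormedField k]

theorem charZero (hk : IsComplexRealOrPadic k) : CharZero k := by
  obtain ⟨e, -⟩ | ⟨e, -⟩ | ⟨p, _, e, -⟩ := hk <;>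
  exact charZero_of_injective_ringHom (f := e.symm.toRingHom) e.symm.injective

theorem completeSpace_of_ringEquiv {F : Type*} [NontriviallyNormedField F] [CompleteSpace F]
    (e : k ≃+* F) (he : ∀ x, ‖e x‖ = ‖x‖) : CompleteSpace k :=
  (IsometryEquiv.mk e.toEquiv (AddMonoidHomClass.isometry_of_norm e he)).completeSpace

theorem completeSpace (hk : IsComplexRealOrPadic k) : CompleteSpace k := by
  obtain ⟨e, he⟩ | ⟨e, he⟩ | ⟨p, _, e, he⟩ := hk <;> exact completeSpace_of_ringEquiv e he

theorem exists_norm_inv_factorial_le (hk : IsComplexRealOrPadic k) :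
    ∃ c : ℝ, 1 ≤ c ∧ ∀ m : ℕ, ‖((m.factorial : k))⁻¹‖ ≤ c ^ m := by
  obtain ⟨e, he⟩ | ⟨e, he⟩ | ⟨p, _, e, he⟩ := hk
  · refine ⟨1, le_rfl, fun m => ?_⟩
    rw [← he, map_inv₀, map_natCast, norm_inv, Complex.norm_natCast, one_pow]
    exact inv_le_one_of_one_le₀ (by exact_mod_cast m.factorial_pos)
  · refine ⟨1, le_rfl, fun m => ?_⟩
    rw [← he, map_inv₀, map_natCast, norm_inv, Real.norm_natCast, one_pow]
    exact inv_le_one_of_one_le₀ (by exact_mod_cast m.factorial_pos)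
  · have hp : p.Prime := Fact.out
    refine ⟨p, by exact_mod_cast hp.one_le, fun m => ?_⟩
    have hv : padicValNat p m.factorial ≤ m := by
      have h := sub_one_mul_padicValNat_factorial (p := p) m
      have h1 : 1 * padicValNat p m.factorial ≤ (p - 1) * padicValNat p m.factorial :=
        Nat.mul_le_mul_right _ (by have := hp.two_le; omega)
      omega
    rw [← he, map_inv₀, map_natCast, norm_inv,
      Padic.norm_eq_zpow_neg_valuation (by exact_mod_cast m.factorial_ne_zero),
      Padic.valuation_natCast, zpow_neg, inv_inv, zpow_natCast]
    exact pow_le_pow_right₀ (by exact_mod_cast hp.one_le) hv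

theorem expSeries_radius_pos (hk : IsComplexRealOrPadic k) (A : Type*) [NormedRing A]
    [NormedAlgebra k A] : 0 < (NormedSpace.expSeries k A).radius := by
  obtain ⟨c, hc, h⟩ := hk.exists_norm_inv_factorial_le
  have hc0 : 0 < c := by linarith
  have hr : 0 < c.toNNReal⁻¹ := by simpa using hc0
  refine lt_of_lt_of_le (ENNReal.coe_pos.2 hr) ?_
  refine FormalMultilinearSeries.le_radius_of_bound _ (max 1 ‖(1 : A)‖) fun m => ?_
  have h1 : ‖NormedSpace.expSeries k A m‖ ≤ c ^ m * max 1 ‖(1 : A)‖ := by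
    have hM : ‖ContinuousMultilinearMap.mkPiAlgebraFin k m A‖ ≤ max 1 ‖(1 : A)‖ := by
      obtain rfl | hm := Nat.eq_zero_or_pos m
      · exact ContinuousMultilinearMap.norm_mkPiAlgebraFin_zero.le.trans (le_max_right _ _)
      · exact (ContinuousMultilinearMap.norm_mkPiAlgebraFin_le_of_pos hm).trans (le_max_left _ _)
    rw [NormedSpace.expSeries_eq_ofScalars, FormalMultilinearSeries.ofScalars_norm_eq_mul]
    exact (mul_le_mul_of_nonneg_left hM (norm_nonneg ((m.factorial : k)⁻¹))).trans
      (mul_le_mul_of_nonneg_right (h m) (by positivity))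
  have h2 : ((c.toNNReal⁻¹ : NNReal) : ℝ) ^ m = (c ^ m)⁻¹ := by
    simp [Real.coe_toNNReal _ hc0.le]
  rw [h2]
  calc _ ≤ c ^ m * max 1 ‖(1 : A)‖ * (c ^ m)⁻¹ := by gcongr
    _ = _ := by field_simp

end IsComplexRealOrPadic

open scoped Topology in
/-- If the exponential series has positive radius of convergence, then `t ↦ exp (t X)` is analytic
near `0`, has derivative `exp (t X) X`, and takes invertible values. -/
theorem exists_one_parameter_curve_of_radius_pos {k A : Type*} [NontriviallyNormedField k]
    [CharZero k] [NormedRing A] [NormedAlgebra k A] [CompleteSpace A]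
    (h : 0 < (NormedSpace.expSeries k A).radius) (X : A) :
    ∃ E : k → A, E 0 = 1 ∧ AnalyticAt k E 0 ∧
      ∀ᶠ t in 𝓝 (0 : k), HasDerivAt E (E t * X) t ∧ E t * E (-t) = 1 := by
  refine ⟨fun t => NormedSpace.exp (t • X), by simp [NormedSpace.exp_zero], ?_, ?_⟩
  · refine AnalyticAt.fun_comp (g := NormedSpace.exp) (f := fun t : k => t • X) ?_ (by fun_prop)
    rw [zero_smul]
    exact (NormedSpace.hasFPowerSeriesAt_exp_zero_of_radius_pos h).analyticAt
  · have hc : ContinuousAt (fun t : k => t • X) 0 := by fun_prop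
    have hb : ∀ᶠ t in 𝓝 (0 : k), t • X ∈ Metric.eball (0 : A) (NormedSpace.expSeries k A).radius :=
      hc.eventually_mem (by rw [zero_smul]; exact Metric.eball_mem_nhds _ h)
    filter_upwards [hb] with t ht
    constructor
    · simpa using (hasFDerivAt_exp_smul_const_of_mem_ball k X t ht).hasDerivAt
    · have := NormedSpace.invertibleExpOfMemBall ht
      rw [neg_smul, ← NormedSpace.invOf_exp_of_mem_ball ht, mul_invOf_self]

open scoped Topology Matrix.Norms.Operator in
theorem IsComplexRealOrPadic.exists_one_parameter_curve {k : Type*} [NontriviallyNormedField k]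
    (hk : IsComplexRealOrPadic k) {n : ℕ} (X : Matrix (Fin n) (Fin n) k) :
    ∃ E : k → Matrix (Fin n) (Fin n) k, E 0 = 1 ∧ (∀ i j, AnalyticAt k (fun t => E t i j) 0) ∧
      ∀ᶠ t in 𝓝 (0 : k),
        (∀ i j, HasDerivAt (fun t => E t i j) ((E t * X) i j) t) ∧ E t * E (-t) = 1 := by
  have := hk.charZero
  have := hk.completeSpace
  have : @CompleteSpace (Matrix (Fin n) (Fin n) k) PseudoMetricSpace.toUniformSpace :=
    FiniteDimensional.complete k _
  obtain ⟨E, h0, ha, he⟩ := exists_one_parameter_curve_of_radius_pos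
    (hk.expSeries_radius_pos (Matrix (Fin n) (Fin n) k)) X
  let ℓ : ∀ i j, Matrix (Fin n) (Fin n) k →L[k] k := fun i j =>
    LinearMap.toContinuousLinearMap (Matrix.entryLinearMap k k i j)
  refine ⟨E, h0, fun i j => (ℓ i j).analyticAt _ |>.comp ha, ?_⟩
  filter_upwards [he] with t ht
  exact ⟨fun i j => (ℓ i j).hasFDerivAt.comp_hasDerivAt t ht.1, ht.2⟩

namespace LinAlgGroup

open MvPolynomial

section rational

variable {k K : Type*} [Field k] [Field K] [Algebra k K] {n : ℕ}

theorem eval_coords_map (A : Matrix (Fin n) (Fin n) k) (P : MvPolynomial (Fin n × Fin n) k) :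
    eval (coords (A.map (algebraMap k K))) (MvPolynomial.map (algebraMap k K) P) =
      algebraMap k K (eval (coords A) P) := by
  rw [eval_map]
  exact (eval₂_comp_left (algebraMap k K) (RingHom.id k) _ P).symm

theorem leftDer_map (X : Matrix (Fin n) (Fin n) k) (P : MvPolynomial (Fin n × Fin n) k) :
    leftDer (X.map (algebraMap k K)) (MvPolynomial.map (algebraMap k K) P) =
      MvPolynomial.map (algebraMap k K) (leftDer X P) := by
  induction P using MvPolynomial.induction_on with
  | C a => simp
  | add p q hp hq => simp [hp, hq]
  | mul_X p q hp =>
    have hX : leftDer (X.map (algebraMap k K)) (MvPolynomial.X q) =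
        MvPolynomial.map (algebraMap k K) (leftDer X (MvPolynomial.X q)) := by
      simp [leftDer]
    simp only [map_mul, Derivation.leibniz, smul_eq_mul, map_add, hp, MvPolynomial.map_X, hX]

theorem dAtOne_map (P : MvPolynomial (Fin n × Fin n) k) (X : Matrix (Fin n) (Fin n) k) :
    dAtOne (MvPolynomial.map (algebraMap k K) P) (X.map (algebraMap k K)) =
      algebraMap k K (dAtOne P X) := by
  rw [dAtOne_eq, dAtOne_eq, leftDer_map, ← eval_coords_map, Matrix.map_one _ (map_zero _)
    (map_one _)]

theorem dAtOne_mul (P Q : MvPolynomial (Fin n × Fin n) K) (X : Matrix (Fin n) (Fin n) K) :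
    dAtOne (P * Q) X = eval (coords (1 : Matrix (Fin n) (Fin n) K)) P * dAtOne Q X +
      eval (coords (1 : Matrix (Fin n) (Fin n) K)) Q * dAtOne P X := by
  simp only [dAtOne_eq, Derivation.leibniz, smul_eq_mul, map_add, map_mul]

theorem dAtOne_add (P Q : MvPolynomial (Fin n × Fin n) K) (X : Matrix (Fin n) (Fin n) K) :
    dAtOne (P + Q) X = dAtOne P X + dAtOne Q X := by
  simp only [dAtOne_eq, map_add]

/-- The ideal of the polynomials with coefficients in `k` that vanish on `G`. -/
noncomputable def rationalIdeal (k : Type*) {K : Type*} [Field k] [Field K] [Algebra k K] {n : ℕ}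
    (G : Subgroup (GL (Fin n) K)) : Ideal (MvPolynomial (Fin n × Fin n) k) :=
  (ideal G).comap (MvPolynomial.map (algebraMap k K))

variable {G : Subgroup (GL (Fin n) K)}

theorem mem_rationalIdeal {P : MvPolynomial (Fin n × Fin n) k} :
    P ∈ rationalIdeal k G ↔ MvPolynomial.map (algebraMap k K) P ∈ ideal G := Iff.rfl

theorem IsDefinedOver.ideal_eq (hG : IsDefinedOver k G) :
    ideal G = (rationalIdeal k G).map (MvPolynomial.map (algebraMap k K)) := by
  refine le_antisymm ?_ Ideal.map_comap_le
  obtain ⟨S, hS⟩ := hG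
  rw [hS, Ideal.span_le]
  rintro _ ⟨P, hP, rfl⟩
  refine Ideal.mem_map_of_mem _ (mem_rationalIdeal.2 ?_)
  rw [hS]
  exact Ideal.subset_span ⟨P, hP, rfl⟩

theorem leftDer_mem_rationalIdeal {X : Matrix (Fin n) (Fin n) k} (hX : X ∈ lieAlgebraPoints k G)
    {P : MvPolynomial (Fin n × Fin n) k} (hP : P ∈ rationalIdeal k G) :
    leftDer X P ∈ rationalIdeal k G := by
  rw [mem_rationalIdeal, ← leftDer_map]
  exact leftDer_mem hX hP

theorem eval_one_eq_zero {P : MvPolynomial (Fin n × Fin n) k} (hP : P ∈ rationalIdeal k G) :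
    eval (coords (1 : Matrix (Fin n) (Fin n) k)) P = 0 := by
  have h := mem_ideal.1 (mem_rationalIdeal.1 hP) 1 G.one_mem
  rw [Units.val_one, ← Matrix.map_one (algebraMap k K) (map_zero _) (map_one _),
    eval_coords_map] at h
  exact (map_eq_zero _).1 h

theorem eval_rationalPoints_eq_zero {P : MvPolynomial (Fin n × Fin n) k}
    (hP : P ∈ rationalIdeal k G) (g : rationalPoints k G) :
    eval (coords ((g : GL (Fin n) k) : Matrix (Fin n) (Fin n) k)) P = 0 := by
  have h := mem_ideal.1 (mem_rationalIdeal.1 hP)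
    (Matrix.GeneralLinearGroup.map (algebraMap k K) g) g.2
  exact (map_eq_zero _).1 ((eval_coords_map _ P).symm.trans h)

theorem mem_rationalPoints_of_eval_eq_zero (hG : IsZariskiClosed G) (hGk : IsDefinedOver k G)
    {g : GL (Fin n) k}
    (hg : ∀ P ∈ rationalIdeal k G, eval (coords (g : Matrix (Fin n) (Fin n) k)) P = 0) :
    g ∈ rationalPoints k G := by
  obtain ⟨I, hI⟩ := hG
  change Matrix.GeneralLinearGroup.map (algebraMap k K) g ∈ G
  rw [hI, mem_zeroLocus_iff]
  intro P hP
  rw [aeval_eq_eval]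
  have hPG : P ∈ ideal G := mem_ideal.2 fun g hg => by
    have := (hI g).1 hg
    rw [mem_zeroLocus_iff] at this
    simpa [aeval_eq_eval] using this P hP
  have hle : ideal G ≤ RingHom.ker (eval (coords
      ((g : Matrix (Fin n) (Fin n) k).map (algebraMap k K)))) := by
    rw [hGk.ideal_eq, Ideal.map_le_iff_le_comap]
    intro Q hQ
    rw [Ideal.mem_comap, RingHom.mem_ker, eval_coords_map, hg Q hQ, map_zero]
  exact hle hPG

/-- To lie in `L(G)_k` it suffices to annihilate the differentials of the polynomials over `k`
vanishing on `G`. -/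
theorem mem_lieAlgebraPoints_of_dAtOne_eq_zero (hGk : IsDefinedOver k G)
    {X : Matrix (Fin n) (Fin n) k} (hX : ∀ P ∈ rationalIdeal k G, dAtOne P X = 0) :
    X ∈ lieAlgebraPoints k G := by
  change ∀ P ∈ ideal G, dAtOne P (X.map (algebraMap k K)) = 0
  have hspan : ideal G = Ideal.span (MvPolynomial.map (algebraMap k K) '' (rationalIdeal k G)) :=
    hGk.ideal_eq
  intro P hP
  rw [hspan] at hP
  induction hP using Submodule.span_induction with
  | mem P h =>
    obtain ⟨Q, hQ, rfl⟩ := h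
    rw [dAtOne_map, hX Q hQ, map_zero]
  | zero => simp [dAtOne]
  | add P Q _ _ ihP ihQ => rw [dAtOne_add, ihP, ihQ, add_zero]
  | smul a Q hQ ihQ =>
    have h1 := mem_ideal.1 (hspan ▸ hQ : Q ∈ ideal G) 1 G.one_mem
    rw [Units.val_one] at h1
    rw [smul_eq_mul, dAtOne_mul, ihQ, h1, mul_zero, zero_mul, add_zero]

end rational

section curve

open scoped Topology

variable {k K : Type*} [NontriviallyNormedField k] [Field K] [Algebra k K] {n : ℕ}

theorem hasDerivAt_eval_coords {E : k → Matrix (Fin n) (Fin n) k} {X : Matrix (Fin n) (Fin n) k}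
    {t : k} (hE : ∀ i j, HasDerivAt (fun t => E t i j) ((E t * X) i j) t)
    (P : MvPolynomial (Fin n × Fin n) k) :
    HasDerivAt (fun t => eval (coords (E t)) P) (eval (coords (E t)) (leftDer X P)) t := by
  induction P using MvPolynomial.induction_on with
  | C a => simpa using hasDerivAt_const t a
  | add p q hp hq => simpa using hp.fun_add hq
  | mul_X p q hp =>
    have h : HasDerivAt (fun t => eval (coords (E t)) (MvPolynomial.X q))
        (eval (coords (E t)) (leftDer X (MvPolynomial.X q))) t := by
      simpa [leftDer, coords, Matrix.mul_apply] using hE q.1 q.2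
    simp only [Derivation.leibniz, smul_eq_mul, map_add, map_mul]
    convert! hp.fun_mul h using 1
    ring

theorem analyticAt_eval_coords {E : k → Matrix (Fin n) (Fin n) k} {t : k}
    (hE : ∀ i j, AnalyticAt k (fun t => E t i j) t) (P : MvPolynomial (Fin n × Fin n) k) :
    AnalyticAt k (fun t => eval (coords (E t)) P) t := by
  induction P using MvPolynomial.induction_on with
  | C a => simpa using analyticAt_const
  | add p q hp hq => simpa using hp.fun_add hq
  | mul_X p q hp => simpa [coords] using hp.fun_mul (hE q.1 q.2)

theorem eventually_eq_zero_of_iteratedDeriv_eq_zero [CompleteSpace k] [CharZero k] {f : k → k}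
    {x : k} (hf : AnalyticAt k f x) (h : ∀ m, iteratedDeriv m f x = 0) : ∀ᶠ t in 𝓝 x, f t = 0 := by
  have hp := hf.hasFPowerSeriesAt
  have h0 : (FormalMultilinearSeries.ofScalars k fun m => iteratedDeriv m f x / m.factorial) =
      0 := by
    rw [FormalMultilinearSeries.ofScalars_series_eq_zero]
    ext m
    simp [h m]
  rw [h0] at hp
  exact hp.eventually_eq_zero

variable {G : Subgroup (GL (Fin n) K)}

theorem eventually_mem_rationalPoints (hk : IsComplexRealOrPadic k) (hG : IsZariskiClosed G)
    (hGk : IsDefinedOver k G) {X : Matrix (Fin n) (Fin n) k} (hX : X ∈ lieAlgebraPoints k G)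
    {E : k → Matrix (Fin n) (Fin n) k} (h0 : E 0 = 1)
    (hE : ∀ i j, AnalyticAt k (fun t => E t i j) 0)
    (hE' : ∀ᶠ t in 𝓝 (0 : k),
      (∀ i j, HasDerivAt (fun t => E t i j) ((E t * X) i j) t) ∧ E t * E (-t) = 1) :
    ∀ᶠ t in 𝓝 (0 : k), ∃ g : rationalPoints k G,
      (g : GL (Fin n) k).1 = E t ∧ (g : GL (Fin n) k)⁻¹.1 = E (-t) := by
  have := hk.charZero
  have := hk.completeSpace
  have hderiv : ∀ (m : ℕ) (P : MvPolynomial (Fin n × Fin n) k), ∀ᶠ t in 𝓝 (0 : k),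
      iteratedDeriv m (fun t => eval (coords (E t)) P) t =
        eval (coords (E t)) ((leftDer X)^[m] P) := by
    intro m P
    induction m with
    | zero => simp
    | succ m ih =>
      filter_upwards [ih.eventually_nhds, hE'] with t ht ht'
      rw [iteratedDeriv_succ, Filter.EventuallyEq.deriv_eq ht, Function.iterate_succ_apply']
      exact (hasDerivAt_eval_coords ht'.1 _).deriv
  have hiter : ∀ (m : ℕ) (P : MvPolynomial (Fin n × Fin n) k), P ∈ rationalIdeal k G →
      (leftDer X)^[m] P ∈ rationalIdeal k G := by
    intro m P hP
    induction m with
    | zero => exact hP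
    | succ m ih =>
      rw [Function.iterate_succ_apply']
      exact leftDer_mem_rationalIdeal hX ih
  have hzero : ∀ P ∈ rationalIdeal k G, ∀ᶠ t in 𝓝 (0 : k), eval (coords (E t)) P = 0 := by
    intro P hP
    refine eventually_eq_zero_of_iteratedDeriv_eq_zero (analyticAt_eval_coords hE P) fun m => ?_
    rw [(hderiv m P).self_of_nhds, h0]
    exact eval_one_eq_zero (hiter m P hP)
  obtain ⟨S, hS⟩ := IsNoetherian.noetherian (rationalIdeal k G)
  have hfin : ∀ᶠ t in 𝓝 (0 : k), ∀ P ∈ S, eval (coords (E t)) P = 0 := by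
    rw [Filter.eventually_all_finset]
    exact fun P hP => hzero P (hS ▸ Submodule.subset_span hP)
  filter_upwards [hfin, hE'] with t ht ht'
  refine ⟨⟨⟨E t, E (-t), ht'.2, mul_eq_one_comm.1 ht'.2⟩,
    mem_rationalPoints_of_eval_eq_zero hG hGk fun P hP => ?_⟩, rfl, rfl⟩
  have hle : rationalIdeal k G ≤ RingHom.ker (eval (coords (E t))) := by
    rw [← hS]
    exact Ideal.span_le.2 ht
  exact hle hP

/-- A subspace of `M_n(k)` that is invariant under conjugation by `G_k` is invariant under bracket
with `L(G)_k`. -/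
theorem lie_mem_of_conj_mem (hk : IsComplexRealOrPadic k) (hG : IsZariskiClosed G)
    (hGk : IsDefinedOver k G) {T : Submodule k (Matrix (Fin n) (Fin n) k)}
    (hT : ∀ g : rationalPoints k G, ∀ Y ∈ T, (g : GL (Fin n) k).1 * Y * (g : GL (Fin n) k)⁻¹.1 ∈ T)
    {X Y : Matrix (Fin n) (Fin n) k} (hX : X ∈ lieAlgebraPoints k G) (hY : Y ∈ T) :
    ⁅X, Y⁆ ∈ T := by
  obtain ⟨E, h0, ha, hE⟩ := hk.exists_one_parameter_curve X
  have hmem := eventually_mem_rationalPoints hk hG hGk hX h0 ha hE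
  by_contra hXY
  obtain ⟨φ, hφ, hle⟩ := Submodule.exists_le_ker_of_notMem hXY
  refine hφ ?_
  let c : Fin n → Fin n → k := fun i j => φ (Matrix.single i j 1)
  have hφc : ∀ M, φ M = ∑ i, ∑ j, M i j * c i j := by
    intro M
    conv_lhs => rw [Matrix.matrix_eq_sum_single M]
    simp only [map_sum]
    refine Finset.sum_congr rfl fun i _ => Finset.sum_congr rfl fun j _ => ?_
    rw [← smul_eq_mul, ← map_smul, Matrix.smul_single, smul_eq_mul, mul_one]
  have hd : ∀ i j, HasDerivAt (fun t => E t i j) (X i j) 0 := by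
    intro i j
    simpa [h0] using hE.self_of_nhds.1 i j
  have hd' : ∀ i j, HasDerivAt (fun t => E (-t) i j) (-X i j) 0 := by
    intro i j
    have h1 : HasDerivAt (fun t => E t i j) (X i j) (-0) := by simpa using hd i j
    have h2 := h1.comp (0 : k) (hasDerivAt_neg (0 : k))
    rwa [mul_neg_one] at h2
  have hF : HasDerivAt (fun t => φ (E t * Y * E (-t))) (φ ⁅X, Y⁆) 0 := by
    have h1 : HasDerivAt (fun t => ∑ i, ∑ j, (∑ l, (∑ m, E t i m * Y m l) * E (-t) l j) * c i j)
        (∑ i, ∑ j, (∑ l, ((∑ m, X i m * Y m l) * E (-0) l j +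
          (∑ m, E 0 i m * Y m l) * (-X l j))) * c i j) 0 :=
      HasDerivAt.fun_sum fun i _ => HasDerivAt.fun_sum fun j _ =>
        (HasDerivAt.fun_sum fun l _ =>
          (HasDerivAt.fun_sum fun m _ => (hd i m).mul_const (Y m l)).fun_mul (hd' l j)).mul_const _
    convert! h1 using 1
    · ext t
      simp only [hφc, Matrix.mul_apply]
    · rw [hφc]
      refine Finset.sum_congr rfl fun i _ => Finset.sum_congr rfl fun j _ => ?_
      congr 1
      have h2 : ⁅X, Y⁆ = X * Y * E (-0) + E 0 * Y * (-X) := by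
        rw [neg_zero, h0, Ring.lie_def]
        noncomm_ring
      rw [h2]
      simp only [Matrix.add_apply, Matrix.mul_apply, Matrix.neg_apply, Finset.sum_add_distrib]
  refine hF.unique ((hasDerivAt_const (0 : k) (0 : k)).congr_of_eventuallyEq ?_)
  filter_upwards [hmem] with t ht
  obtain ⟨g, hg, hg'⟩ := ht
  rw [← hg, ← hg']
  exact hle (hT g Y hY)

end curve

end LinAlgGroup

namespace LinAlgGroup

open MvPolynomial

section span

variable {k K : Type*} [Field k] [Field K] [Algebra k K] {n : ℕ}
  {G : Subgroup (GL (Fin n) K)}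

theorem eval_pointCoords_map (g : rationalPoints k G) (P : MvPolynomial (Fin n × Fin n) k) :
    eval (pointCoords g) (MvPolynomial.map (algebraMap k K) P) =
      algebraMap k K (eval (coords ((g : GL (Fin n) k) : Matrix (Fin n) (Fin n) k)) P) :=
  eval_coords_map _ P

/-- Polynomials over `k` that vanish on a Zariski dense subgroup vanish on `G_k`. -/
theorem IsZariskiDense.eval_eq_zero {H : Subgroup (rationalPoints k G)} (hH : IsZariskiDense H)
    {P : MvPolynomial (Fin n × Fin n) k}
    (hP : ∀ h ∈ H, eval (coords ((h : GL (Fin n) k) : Matrix (Fin n) (Fin n) k)) P = 0)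
    (g : rationalPoints k G) :
    eval (coords ((g : GL (Fin n) k) : Matrix (Fin n) (Fin n) k)) P = 0 := by
  have h1 := hH ⟨g, rfl⟩
  rw [mem_zeroLocus_iff] at h1
  have h2 := h1 (MvPolynomial.map (algebraMap k K) P) (by
    rw [mem_vanishingIdeal_iff]
    rintro _ ⟨h, hh, rfl⟩
    change eval _ _ = 0
    rw [eval_pointCoords_map, hP h hh, map_zero])
  change eval _ _ = 0 at h2
  rw [eval_pointCoords_map] at h2
  exact (map_eq_zero _).1 h2

/-- The matrix of coordinate functions. -/
noncomputable def genericMatrix (k : Type*) [Field k] (n : ℕ) :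
    Matrix (Fin n) (Fin n) (MvPolynomial (Fin n × Fin n) k) :=
  Matrix.of fun i j => MvPolynomial.X (i, j)

theorem map_eval_genericMatrix (A : Matrix (Fin n) (Fin n) k) :
    (eval (coords A)).mapMatrix (genericMatrix k n) = A := by
  ext i j
  simp [genericMatrix, coords]

theorem eval_adjugate_genericMatrix (A : Matrix (Fin n) (Fin n) k) (i j : Fin n) :
    eval (coords A) ((genericMatrix k n).adjugate i j) = A.adjugate i j := by
  have h := RingHom.map_adjugate (eval (coords A)) (genericMatrix k n)
  rw [map_eval_genericMatrix] at h
  rw [← h]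
  rfl

theorem exists_eval_eq_det_mul (φ : Module.Dual k (Module.End k (lieAlgebraPoints k G))) :
    ∃ P : MvPolynomial (Fin n × Fin n) k, ∀ g : rationalPoints k G,
      eval (coords ((g : GL (Fin n) k) : Matrix (Fin n) (Fin n) k)) P =
        ((g : GL (Fin n) k) : Matrix (Fin n) (Fin n) k).det * φ (Ad k G g) := by
  set V := (lieAlgebraPoints k G).toSubmodule
  obtain ⟨π, hπ⟩ := V.subtype.exists_leftInverse_of_injective V.ker_subtype
  let Φ : Matrix (Fin n) (Fin n) k →ₗ[k] Matrix (Fin n) (Fin n) k →ₗ[k] k :=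
    LinearMap.mk₂ k (fun A B => φ (π ∘ₗ LinearMap.mulLeft k A ∘ₗ LinearMap.mulRight k B ∘ₗ
        V.subtype))
      (fun A A' B => by rw [← map_add]; congr 1; ext1 x; simp [add_mul])
      (fun c A B => by rw [← map_smul]; congr 1; ext1 x; simp)
      (fun A B B' => by rw [← map_add]; congr 1; ext1 x; simp [mul_add])
      (fun c A B => by rw [← map_smul]; congr 1; ext1 x; simp)
  have hΦ : ∀ g : rationalPoints k G,
      Φ ((g : GL (Fin n) k) : Matrix (Fin n) (Fin n) k) (g : GL (Fin n) k)⁻¹.1 =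
        φ (Ad k G g) := by
    intro g
    simp only [Φ, LinearMap.mk₂_apply]
    congr 1
    ext1 x
    have := LinearMap.congr_fun hπ (Ad k G g x)
    simp only [LinearMap.comp_apply, LinearMap.id_apply] at this
    rw [← this]
    simp only [LinearMap.comp_apply, LinearMap.mulLeft_apply, LinearMap.mulRight_apply, ← mul_assoc]
    rfl
  refine ⟨∑ a, ∑ b, ∑ c, ∑ d, MvPolynomial.X (a, b) * (genericMatrix k n).adjugate c d *
    C (Φ (Matrix.single a b 1) (Matrix.single c d 1)), fun g => ?_⟩
  set A := ((g : GL (Fin n) k) : Matrix (Fin n) (Fin n) k)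
  have hadj : A.det • (g : GL (Fin n) k)⁻¹.1 = A.adjugate := by
    have h1 : A * (g : GL (Fin n) k)⁻¹.1 = 1 := Units.mul_inv _
    calc A.det • (g : GL (Fin n) k)⁻¹.1 = (A.adjugate * A) * (g : GL (Fin n) k)⁻¹.1 := by
          rw [Matrix.adjugate_mul, smul_mul_assoc, one_mul]
      _ = A.adjugate := by rw [mul_assoc, h1, mul_one]
  have hexp : ∀ A B : Matrix (Fin n) (Fin n) k, Φ A B = ∑ a, ∑ b, ∑ c, ∑ d,
      A a b * B c d * Φ (Matrix.single a b 1) (Matrix.single c d 1) := by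
    intro A B
    have hs : ∀ (M : Matrix (Fin n) (Fin n) k) i j,
        Matrix.single i j (M i j) = M i j • Matrix.single i j (1 : k) := by
      intro M i j; simp
    conv_lhs => rw [Matrix.matrix_eq_sum_single A]
    simp only [map_sum, LinearMap.sum_apply]
    refine Finset.sum_congr rfl fun a _ => Finset.sum_congr rfl fun b _ => ?_
    conv_lhs => rw [Matrix.matrix_eq_sum_single B]
    simp only [hs, map_sum, map_smul, LinearMap.smul_apply, smul_eq_mul]
    exact Finset.sum_congr rfl fun c _ => Finset.sum_congr rfl fun d _ => by ring
  rw [← hΦ, ← smul_eq_mul, ← map_smul, hadj, hexp]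
  simp only [map_sum, map_mul, eval_X, eval_C, eval_adjugate_genericMatrix]
  rfl

theorem span_Ad_image_eq {H : Subgroup (rationalPoints k G)} (hH : IsZariskiDense H) :
    Submodule.span k (Ad k G '' (H : Set (rationalPoints k G))) =
      Submodule.span k (Set.range (Ad k G)) := by
  refine le_antisymm (Submodule.span_mono (Set.image_subset_range _ _)) ?_
  rw [Submodule.span_le]
  rintro _ ⟨g, rfl⟩
  by_contra hg
  obtain ⟨φ, hφ, hle⟩ := Submodule.exists_le_ker_of_notMem hg
  obtain ⟨P, hP⟩ := exists_eval_eq_det_mul φ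
  have h0 := hH.eval_eq_zero (P := P) (fun h hh => by
    rw [hP, LinearMap.mem_ker.1 (hle (Submodule.subset_span ⟨h, hh, rfl⟩)), mul_zero]) g
  rw [hP] at h0
  refine (mul_ne_zero ?_ hφ) h0
  exact ((Matrix.isUnit_iff_isUnit_det _).1 (Units.isUnit (g : GL (Fin n) k))).ne_zero

end span

end LinAlgGroup

namespace LinAlgGroup

open MvPolynomial

section tangent

variable {k K : Type*} [NontriviallyNormedField k] [Field K] [Algebra k K] {n : ℕ}

theorem exists_hasFDerivAt_eval {y : Fin n → Fin n → k} (hy : Matrix.of y = 1)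
    (P : MvPolynomial (Fin n × Fin n) k) :
    ∃ D : (Fin n → Fin n → k) →L[k] k,
      HasFDerivAt (fun y : Fin n → Fin n → k => eval (fun q => y q.1 q.2) P) D y ∧
      ∀ v, D v = dAtOne P (Matrix.of v) := by
  induction P using MvPolynomial.induction_on with
  | C a => exact ⟨0, by simpa using hasFDerivAt_const a _, by simp [dAtOne]⟩
  | add p q hp hq =>
    obtain ⟨D, hD, hD'⟩ := hp
    obtain ⟨F, hF, hF'⟩ := hq
    exact ⟨D + F, by simpa using hD.fun_add hF, fun v => by simp [hD', hF', dAtOne_add]⟩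
  | mul_X p q hp =>
    obtain ⟨D, hD, hD'⟩ := hp
    let F : (Fin n → Fin n → k) →L[k] k :=
      (ContinuousLinearMap.proj (R := k) (φ := fun _ => k) q.2).comp
        (ContinuousLinearMap.proj (R := k) (φ := fun _ => Fin n → k) q.1)
    have hF : HasFDerivAt (fun y : Fin n → Fin n → k => y q.1 q.2) F y := F.hasFDerivAt
    refine ⟨_, by simpa only [map_mul, eval_X] using hD.fun_mul hF, fun v => ?_⟩
    have hX : dAtOne (MvPolynomial.X q) (Matrix.of v) = v q.1 q.2 := by
      rw [dAtOne_eq]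
      simp [leftDer, coords, Matrix.one_apply]
    rw [dAtOne_mul, hX, eval_X, ← hy, ← hD']
    rfl

variable {G : Subgroup (GL (Fin n) K)} {H : Subgroup (rationalPoints k G)}
  {E : Type*} [NormedAddCommGroup E] [NormedSpace k E] {L : Type*} [Group L]
  [TopologicalSpace L] [ChartedSpace E L] {ι : L →* rationalPoints k G}

/-- The differential of `ι` at the identity. -/
noncomputable def differentialAtOne (E : Type*) [NormedAddCommGroup E] [NormedSpace k E]
    {L : Type*} [Group L] [TopologicalSpace L] [ChartedSpace E L]
    (ι : L →* rationalPoints k G) : E →L[k] (Fin n → Fin n → k) :=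
  mfderiv 𝓘(k, E) 𝓘(k, Fin n → Fin n → k) (toArray ι) (1 : L)

theorem mem_tangentAtOne {X : Matrix (Fin n) (Fin n) k} :
    X ∈ tangentAtOne E ι ↔ ∃ v : E, Matrix.of (differentialAtOne E ι v) = X := by
  constructor
  · rintro ⟨_, ⟨v, rfl⟩, rfl⟩
    exact ⟨v, rfl⟩
  · rintro ⟨v, rfl⟩
    exact ⟨_, ⟨v, rfl⟩, rfl⟩

theorem of_toArray {L : Type*} [Group L] (ι : L →* rationalPoints k G) (x : L) :
    Matrix.of (toArray ι x) = (ι x : GL (Fin n) k).1 :=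
  rfl

theorem of_toArray_one {L : Type*} [Group L] (ι : L →* rationalPoints k G) :
    Matrix.of (toArray ι (1 : L)) = 1 := by
  rw [of_toArray, map_one]
  rfl

theorem IsAnalyticSubgroup.hasMFDerivAt_one (h : IsAnalyticSubgroup H E ι) :
    HasMFDerivAt 𝓘(k, E) 𝓘(k, Fin n → Fin n → k) (toArray ι) (1 : L) (differentialAtOne E ι) :=
  (h.analytic.mdifferentiable (by simp) 1).hasMFDerivAt

theorem IsAnalyticSubgroup.tangentAtOne_le (h : IsAnalyticSubgroup H E ι)
    (hGk : IsDefinedOver k G) : tangentAtOne E ι ≤ (lieAlgebraPoints k G).toSubmodule := by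
  intro X hX
  obtain ⟨v, rfl⟩ := mem_tangentAtOne.1 hX
  refine mem_lieAlgebraPoints_of_dAtOne_eq_zero hGk fun P hP => ?_
  obtain ⟨D, hD, hD'⟩ := exists_hasFDerivAt_eval (of_toArray_one ι) P
  have h1 : HasMFDerivAt 𝓘(k, E) 𝓘(k, k)
      ((fun y : Fin n → Fin n → k => eval (fun q => y q.1 q.2) P) ∘ toArray ι) (1 : L)
      (D ∘L differentialAtOne E ι) := hD.hasMFDerivAt.comp (1 : L) h.hasMFDerivAt_one
  have h2 : ((fun y : Fin n → Fin n → k => eval (fun q => y q.1 q.2) P) ∘ toArray ι) =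
      fun _ : L => (0 : k) := by
    funext x
    exact eval_rationalPoints_eq_zero hP (ι x)
  rw [h2] at h1
  have h3 : D ∘L differentialAtOne E ι = 0 :=
    hasMFDerivAt_unique h1 (hasMFDerivAt_const (I := 𝓘(k, E)) (0 : k) (1 : L))
  rw [← hD']
  exact DFunLike.congr_fun h3 v

/-- Conjugation on `n × n` arrays. -/
noncomputable def conjArray [CompleteSpace k] (g : GL (Fin n) k) :
    (Fin n → Fin n → k) →L[k] (Fin n → Fin n → k) :=
  LinearMap.toContinuousLinearMap
    ((Matrix.ofLinearEquiv k).symm.toLinearMap ∘ₗ LinearMap.mulLeft k g.1 ∘ₗ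
      LinearMap.mulRight k g⁻¹.1 ∘ₗ (Matrix.ofLinearEquiv k).toLinearMap)

theorem of_conjArray [CompleteSpace k] (g : GL (Fin n) k) (v : Fin n → Fin n → k) :
    Matrix.of (conjArray g v) = g.1 * Matrix.of v * g⁻¹.1 := by
  rw [mul_assoc]
  rfl

theorem IsAnalyticSubgroup.conj_mem_tangentAtOne [CompleteSpace k]
    (h : IsAnalyticSubgroup H E ι) {g : rationalPoints k G} (hg : g ∈ H)
    {Y : Matrix (Fin n) (Fin n) k} (hY : Y ∈ tangentAtOne E ι) :
    (g : GL (Fin n) k).1 * Y * (g : GL (Fin n) k)⁻¹.1 ∈ tangentAtOne E ι := by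
  obtain ⟨v, rfl⟩ := mem_tangentAtOne.1 hY
  rw [← h.range_eq] at hg
  obtain ⟨x, rfl⟩ := hg
  have := h.lieGroup
  have hc : MDifferentiable 𝓘(k, E) 𝓘(k, E) fun y : L => x * y * x⁻¹ :=
    ((contMDiff_mul_right (I := 𝓘(k, E)) (n := ω) (a := x⁻¹)).comp
      (contMDiff_mul_left (I := 𝓘(k, E)) (n := ω) (a := x))).mdifferentiable (by simp)
  have hc1 := (hc 1).hasMFDerivAt
  have hf : HasMFDerivAt 𝓘(k, E) 𝓘(k, Fin n → Fin n → k) (toArray ι) (x * 1 * x⁻¹)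
      (differentialAtOne E ι) := by
    rw [mul_one, mul_inv_cancel]
    exact h.hasMFDerivAt_one
  have h1 := hf.comp (1 : L) hc1
  have h2 := (conjArray (ι x : GL (Fin n) k)).hasMFDerivAt.comp (1 : L) h.hasMFDerivAt_one
  have h3 : (toArray ι ∘ fun y : L => x * y * x⁻¹) =
      conjArray (ι x : GL (Fin n) k) ∘ toArray ι := by
    funext y
    apply Matrix.of.injective
    rw [Function.comp_apply, Function.comp_apply, of_conjArray]
    rw [of_toArray, of_toArray, map_mul, map_mul, map_inv]
    rfl
  rw [h3] at h1
  have h4 := DFunLike.congr_fun (hasMFDerivAt_unique h1 h2) v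
  refine mem_tangentAtOne.2 ⟨_, (congrArg Matrix.of h4).trans ?_⟩
  exact of_conjArray _ _

end tangent

end LinAlgGroup

theorem mainTheorem8 {k : Type*} [NontriviallyNormedField k] (hk : IsComplexRealOrPadic k)
    {K : Type*} [Field K] [IsAlgClosed K] [Algebra k K] {n : ℕ}
    (G : Subgroup (GL (Fin n) K)) (hG : LinAlgGroup.IsZariskiClosed G)
    (hGk : LinAlgGroup.IsDefinedOver k G)
    (H : Subgroup (LinAlgGroup.rationalPoints k G)) (hH : LinAlgGroup.IsZariskiDense H) :
    Submodule.span k (LinAlgGroup.Ad k G '' (H : Set (LinAlgGroup.rationalPoints k G))) =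
        Submodule.span k (Set.range (LinAlgGroup.Ad k G)) ∧
      ∀ {E : Type*} [NormedAddCommGroup E] [NormedSpace k E] {L : Type*} [Group L]
        [TopologicalSpace L] [ChartedSpace E L] (ι : L →* LinAlgGroup.rationalPoints k G),
        LinAlgGroup.IsAnalyticSubgroup H E ι →
          ∃ J : LieIdeal k (LinAlgGroup.lieAlgebraPoints k G),
            J.toSubmodule.map (LinAlgGroup.lieAlgebraPoints k G).toSubmodule.subtype =
              LinAlgGroup.tangentAtOne E ι := by
  have hspan := LinAlgGroup.span_Ad_image_eq hH
  refine ⟨hspan, fun {E} _ _ {L} _ _ _ ι hι => ?_⟩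
  have := hk.completeSpace
  have hle := hι.tangentAtOne_le hGk
  set V := LinAlgGroup.lieAlgebraPoints k G
  set T := LinAlgGroup.tangentAtOne E ι
  set T' : Submodule k V := T.comap V.toSubmodule.subtype
  have hstab : Submodule.span k (Set.range (LinAlgGroup.Ad k G)) ≤
      Submodule.compatibleMaps T' T' := by
    rw [← hspan, Submodule.span_le]
    rintro _ ⟨g, hg, rfl⟩ Y hY
    exact hι.conj_mem_tangentAtOne hg hY
  have hconj : ∀ g : LinAlgGroup.rationalPoints k G, ∀ Y ∈ T,
      (g : GL (Fin n) k).1 * Y * (g : GL (Fin n) k)⁻¹.1 ∈ T := fun g Y hY =>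
    hstab (Submodule.subset_span ⟨g, rfl⟩) (show (⟨Y, hle hY⟩ : V) ∈ T' from hY)
  refine ⟨{ T' with lie_mem := fun {X Y} hY =>
    LinAlgGroup.lie_mem_of_conj_mem hk hG hGk hconj X.2 hY }, ?_⟩
  exact (Submodule.map_comap_subtype _ _).trans (inf_eq_right.2 hle)
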